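/- Let $M$ be a finitary matroid (a possibly infinite matroid in which every set whose finite subsets are all independent is itself independent), let $B_0$ and $B_1$ be bases of $M$, let $\kappa$ be a cardinal, and let $B_0=\bigcup_{i<\kappa}X_i$ be a partition of $B_0$ into pairwise disjoint finite sets $X_i$ (empty $X_i$ are allowed). Then there are a partition $B_1=\bigcup_{i<\kappa}Y_i$ into pairwise disjoint sets, with $Y_i\neq\emptyset$ whenever $X_i\neq\emptyset$, and a bijection $\sigma:\kappa\to\kappa$ such that for every $i<\kappa$ both $$(B_0\setminus X_i)\cup Y_i\qquad\text{and}\qquad \Bigl(B_0\setminus\bigcup_{i\le j<\kappa}X_{\sigma(j)}\Bigr)\cup\bigcup_{i\le j<\kappa}Y_{\sigma(j)}$$ are bases of $M$. If $\kappa\le\omega$, then $\sigma$ can be chosen to be the identity. -/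

import Mathlib

universe u v

/-!
The engine is a symmetric exchange: for bases `B₀`, `B₁` and a finite `X ⊆ B₀` there is `Y ⊆ B₁`
such that `B₀ \ X ∪ Y` and `B₁ \ Y ∪ X` are both bases. Take a finite `F ⊆ B₁` spanning `X`. By
submodularity of the rank, every `A ⊆ F` satisfies `|A| ≤ r (A / X) + r (A / (B₀ \ X))`, so `F`
splits into a part `Y` independent in `M / (B₀ \ X)` and a part `F \ Y` independent in `M / X`;
counting shows that `Y` has the size of `X` and that `F \ Y ∪ X` spans the same flat as `F`.

Along a well-order of the blocks, apply this repeatedly to `B₀` and the current base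
`B₁ \ ⋃ k < i, Y k ∪ ⋃ k < i, X k`. A limit step succeeds when the blocks exchanged so far span the
same flat as some subset `C` of `B₁`, and then `⋃ k < i, Y k = C`. If `κ ≤ ω`, the only limit index
is `0`. Otherwise each block depends on countably many others, in the sense that a union of blocks
over an index set closed under this dependence has such a `C`, and since `κ` is an uncountable
cardinal, its elements can be relisted in order type `κ` with all limit initial segments closed.
-/

open Set Cardinal
open scoped Matroid Ordinal

variable {α ι : Type*} {M : Matroid α}

lemma eRk_contract_add_eRk (M : Matroid α) (C A : Set α) :
    (M ／ C).eRk A + M.eRk C = M.eRk (A ∪ C) := by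
  obtain ⟨I, hI⟩ := M.exists_isBasis' C
  obtain ⟨J, hJ, hIJ⟩ := hI.indep.subset_isBasis'_of_subset (hI.subset.trans subset_union_right)
  have hJC : J ∩ C = I := (hI.eq_of_subset_indep (hJ.indep.subset inter_subset_left)
    (subset_inter hIJ hI.subset) inter_subset_right).symm
  have hbasis : (M ／ C).IsBasis' (J \ C) ((A ∪ C) \ C) :=
    hJ.contract_isBasis' hI (hJ.indep.subset (union_subset sdiff_subset hIJ))
  have hA : (M ／ C).eRk A = (M ／ C).eRk ((A ∪ C) \ C) := by
    rw [← Matroid.eRk_inter_ground, ← Matroid.eRk_inter_ground (X := _ \ _),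
      Matroid.contract_ground]
    congr 1
    grind
  rw [hA, hbasis.eRk_eq_encard, hI.eRk_eq_encard, hJ.eRk_eq_encard, ← hJC,
    encard_sdiff_add_encard_inter]

lemma eRk_contract_le (M : Matroid α) (C A : Set α) : (M ／ C).eRk A ≤ M.eRk A := by
  obtain ⟨I, hI⟩ := (M ／ C).exists_isBasis' A
  rw [hI.eRk_eq_encard]
  exact hI.indep.of_contract.encard_le_eRk_of_subset hI.subset

lemma encard_le_eRk_contract_add_eRk_contract {X R A : Set α} (hXR : M.Indep (X ∪ R))
    (hdisj : Disjoint X R) (hX : X.Finite) (hA : M.Indep A) :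
    A.encard ≤ (M ／ X).eRk A + (M ／ R).eRk A := by
  have hXr : M.eRk X = X.encard := (hXR.subset subset_union_left).eRk_eq_encard
  have hXR' : (M ／ R).Indep X :=
    (hXR.subset subset_union_right).contract_indep_iff.2 ⟨hdisj, hXR⟩
  have hX_le : X.encard ≤ (M ／ A).eRk X + (M ／ R).eRk A := calc
    X.encard ≤ (M ／ R).eRk (X ∪ A) := hXR'.encard_le_eRk_of_subset subset_union_left
    _ = (M ／ A ／ R).eRk X + (M ／ R).eRk A := by
      rw [← eRk_contract_add_eRk, Matroid.contract_comm]
    _ ≤ (M ／ A).eRk X + (M ／ R).eRk A := by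
      gcongr
      exact eRk_contract_le (M ／ A) R X
  rw [← ENat.add_le_add_iff_right hX.encard_lt_top.ne]
  calc A.encard + X.encard
    _ ≤ A.encard + ((M ／ A).eRk X + (M ／ R).eRk A) := by gcongr
    _ = M.eRk (X ∪ A) + (M ／ R).eRk A := by
      rw [← eRk_contract_add_eRk, hA.eRk_eq_encard]
      ring
    _ = (M ／ X).eRk A + (M ／ R).eRk A + X.encard := by
      rw [union_comm, ← eRk_contract_add_eRk, hXr]
      ring

lemma add_one_le_eRk_insert_or {M₁ M₂ : Matroid α} {I : Set α} {e : α} (he : e ∉ I) (hI : I.Finite)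
    (h : ∀ A ⊆ insert e I, A.encard ≤ M₁.eRk A + M₂.eRk A) :
    (∀ A ⊆ I, A.encard + 1 ≤ M₁.eRk (insert e A) + M₂.eRk A) ∨
      ∀ A ⊆ I, A.encard + 1 ≤ M₁.eRk A + M₂.eRk (insert e A) := by
  by_contra! hlt
  obtain ⟨⟨A, hA, hA_lt⟩, A', hA', hA'_lt⟩ := hlt
  have hA_fin : A.encard ≠ ⊤ := (hI.subset hA).encard_lt_top.ne
  have hA'_fin : A'.encard ≠ ⊤ := (hI.subset hA').encard_lt_top.ne
  have heA : e ∉ A := fun h ↦ he (hA h)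
  have heA' : e ∉ A' := fun h ↦ he (hA' h)
  have hA_le := ENat.lt_add_one_iff hA_fin |>.1 hA_lt
  have hA'_le := ENat.lt_add_one_iff hA'_fin |>.1 hA'_lt
  have hinter := h (A ∩ A') (inter_subset_left.trans (hA.trans (subset_insert e I)))
  have hunion := h (insert e (A ∪ A')) (insert_subset_insert (union_subset hA hA'))
  have hcard := encard_union_add_encard_inter A A'
  rw [encard_insert_of_notMem (by simp [heA, heA'])] at hunion
  have hsub₁ := M₁.eRk_inter_add_eRk_union_le (insert e A) A'
  have hsub₂ := M₂.eRk_inter_add_eRk_union_le A (insert e A')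
  rw [insert_inter_of_notMem heA', insert_union] at hsub₁
  rw [inter_insert_of_notMem heA, union_insert] at hsub₂
  have := calc A.encard + A'.encard + 1
    _ = (A ∩ A').encard + ((A ∪ A').encard + 1) := by rw [← hcard]; ring
    _ ≤ (M₁.eRk (A ∩ A') + M₂.eRk (A ∩ A')) +
        (M₁.eRk (insert e (A ∪ A')) + M₂.eRk (insert e (A ∪ A'))) := add_le_add hinter hunion
    _ = (M₁.eRk (A ∩ A') + M₁.eRk (insert e (A ∪ A'))) +
        (M₂.eRk (A ∩ A') + M₂.eRk (insert e (A ∪ A'))) := by ring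
    _ ≤ (M₁.eRk (insert e A) + M₁.eRk A') + (M₂.eRk A + M₂.eRk (insert e A')) :=
      add_le_add hsub₁ hsub₂
    _ = (M₁.eRk (insert e A) + M₂.eRk A) + (M₁.eRk A' + M₂.eRk (insert e A')) := by ring
    _ ≤ A.encard + A'.encard := add_le_add hA_le hA'_le
  exact this.not_gt ((ENat.lt_add_one_iff (by simp [*])).2 le_rfl)

lemma exists_indep_indep_sdiff {I : Set α} (hI : I.Finite) : ∀ {M₁ M₂ : Matroid α},
    (∀ A ⊆ I, A.encard ≤ M₁.eRk A + M₂.eRk A) → ∃ Y ⊆ I, M₁.Indep Y ∧ M₂.Indep (I \ Y) := by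
  induction I, hI using Set.Finite.induction_on with
  | empty => exact fun _ ↦ ⟨∅, by simp⟩
  | @insert e I he hI ih =>
    intro M₁ M₂ h
    wlog hstep : ∀ A ⊆ I, A.encard + 1 ≤ M₁.eRk (insert e A) + M₂.eRk A generalizing M₁ M₂
    · have hswap := (add_one_le_eRk_insert_or he hI h).resolve_left hstep
      obtain ⟨Y, hYI, hY, hIY⟩ := this (M₁ := M₂) (M₂ := M₁) (by simpa only [add_comm] using h)
        (by simpa only [add_comm] using hswap)
      exact ⟨insert e I \ Y, sdiff_subset, hIY, by rwa [sdiff_sdiff_cancel_left hYI]⟩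
    have he₁ : M₁.IsNonloop e := by
      rw [← Matroid.eRk_singleton_eq_one_iff]
      refine (M₁.eRk_singleton_le e).antisymm ?_
      simpa using hstep ∅ (empty_subset I)
    have hcontract (A : Set α) (hA : A ⊆ I) : A.encard ≤ (M₁ ／ {e}).eRk A + M₂.eRk A := by
      have := hstep A hA
      rw [← union_singleton, ← eRk_contract_add_eRk, he₁.eRk_eq] at this
      rw [← ENat.add_le_add_iff_right ENat.one_ne_top]
      rwa [add_right_comm]
    obtain ⟨Y, hYI, hY, hIY⟩ := ih hcontract
    refine ⟨insert e Y, insert_subset_insert hYI, (he₁.contractElem_indep_iff.1 hY).2, ?_⟩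
    rwa [insert_sdiff_of_mem _ (mem_insert e Y), sdiff_insert_of_notMem he]

/-- `Exchange M B U P` says that the base `B` of `M` stays a base when `U` is replaced by `P`,
where no element of `P` may already lie in the part `B \ U` that is kept. -/
structure Exchange (M : Matroid α) (B U P : Set α) : Prop where
  isBase : M.IsBase (B \ U ∪ P)
  disjoint : Disjoint (B \ U) P

namespace Exchange

variable {B P U Z : Set α}

lemma of_isBasis (hB : M.IsBase B) (hUB : U ⊆ B) (hU : M.IsBasis U Z) (hP : M.IsBasis P Z) :
    Exchange M B U P := by
  have hdisj : Disjoint Z (B \ U) := by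
    rw [← hU.inter_eq_of_subset_indep hUB hB.indep, sdiff_self_inter]
    exact disjoint_sdiff_right
  have hclosure : M.closure (B \ U ∪ P) = M.closure B := by
    rw [Matroid.closure_union_congr_right (hP.closure_eq_closure.trans hU.closure_eq_closure.symm),
      sdiff_union_of_subset hUB]
  have hindep : M.Indep (B \ U ∪ P) := by
    rw [← hP.contract_indep_iff_of_disjoint hdisj, hU.contract_indep_iff_of_disjoint hdisj,
      sdiff_union_of_subset hUB]
    exact hB.indep
  exact ⟨hindep.isBase_of_ground_subset_closure (hclosure.trans hB.closure_eq).superset,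
    (hdisj.mono_left hP.subset).symm⟩

lemma iff_contract_isBase (hBU : M.Indep (B \ U)) :
    Exchange M B U P ↔ (M ／ (B \ U)).IsBase P := by
  rw [hBU.contract_isBase_iff, union_comm, disjoint_comm]
  exact ⟨fun h ↦ ⟨h.isBase, h.disjoint⟩, fun h ↦ ⟨h.1, h.2⟩⟩

lemma of_encard_le (hB : M.IsBase B) (hUB : U ⊆ B) (hU : U.Finite) (hP : M.Indep P)
    (hPU : P ⊆ M.closure U) (hUP : U.encard ≤ P.encard) : Exchange M B U P := by
  have hU_indep := hB.indep.subset hUB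
  have hPU_encard : P.encard ≤ U.encard := by
    simpa only [M.eRk_closure_eq, hU_indep.eRk_eq_encard] using hP.encard_le_eRk_of_subset hPU
  refine of_isBasis hB hUB hU_indep.isBasis_closure
    (hP.isBasis_of_eRk_ge (hU.finite_of_encard_le hPU_encard) hPU ?_)
  rwa [M.eRk_closure_eq, hU_indep.eRk_eq_encard, hP.eRk_eq_encard]

lemma nonempty (h : Exchange M B U P) (hB : M.IsBase B) (hUB : U ⊆ B) (hU : U.Nonempty) :
    P.Nonempty := by
  by_contra! rfl
  have hBU : M.IsBase (B \ U) := by simpa using h.isBase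
  obtain ⟨e, he⟩ := hU
  exact ((hBU.eq_of_subset_isBase hB sdiff_subset).ge (hUB he)).2 he

end Exchange

lemma exists_contract_indep_contract_indep_sdiff {X R F : Set α} (hXR : M.Indep (X ∪ R))
    (hdisj : Disjoint X R) (hX : X.Finite) (hF : M.Indep F) (hF_fin : F.Finite) :
    ∃ Y ⊆ F, (M ／ R).Indep Y ∧ (M ／ X).Indep (F \ Y) :=
  exists_indep_indep_sdiff hF_fin fun A hA ↦ by
    rw [add_comm]
    exact encard_le_eRk_contract_add_eRk_contract hXR hdisj hX (hF.subset hA)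

lemma exists_symm_exchange [M.Finitary] {B₀ B₁ X : Set α} (hB₀ : M.IsBase B₀)
    (hB₁ : M.IsBase B₁) (hXB : X ⊆ B₀) (hX : X.Finite) :
    ∃ Y ⊆ B₁, Exchange M B₀ X Y ∧ Exchange M B₁ Y X := by
  obtain ⟨F, hFB, hF_fin, hF, hXF⟩ := Matroid.exists_subset_finite_closure_of_subset_closure hX
    (hXB.trans (hB₀.subset_ground.trans_eq hB₁.closure_eq.symm))
  have hX_indep : M.Indep X := hB₀.indep.subset hXB
  have hBX_indep : M.Indep (B₀ \ X) := hB₀.indep.subset sdiff_subset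
  obtain ⟨Y, hYF, hY, hFY⟩ := exists_contract_indep_contract_indep_sdiff
    (by rw [union_sdiff_cancel hXB]; exact hB₀.indep) disjoint_sdiff_right hX hF hF_fin
  obtain ⟨hFYX_disj, hFYX⟩ := hX_indep.contract_indep_iff.1 hFY
  have hFYX_closure : F \ Y ∪ X ⊆ M.closure F :=
    union_subset (sdiff_subset.trans (M.subset_closure F hF.subset_ground)) hXF
  have hX_base : (M ／ (B₀ \ X)).IsBase X :=
    hBX_indep.contract_isBase_iff.2 ⟨by rwa [union_sdiff_cancel hXB], disjoint_sdiff_right⟩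
  have hYX : Y.encard ≤ X.encard := hX_base.encard_eq_eRank ▸ hY.encard_le_eRank
  have hXY : X.encard ≤ Y.encard := by
    have := hFYX.encard_le_eRk_of_subset hFYX_closure
    rw [M.eRk_closure_eq, hF.eRk_eq_encard, encard_union_eq hFYX_disj,
      ← encard_sdiff_add_encard_of_subset hYF] at this
    exact (ENat.add_le_add_iff_left hF_fin.sdiff.encard_lt_top.ne).1 this
  have hFYX_exchange : Exchange M B₁ F (F \ Y ∪ X) := by
    refine .of_encard_le hB₁ hFB hF_fin hFYX hFYX_closure ?_
    rw [encard_union_eq hFYX_disj, ← encard_sdiff_add_encard_of_subset hYF]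
    gcongr
  refine ⟨Y, hYF.trans hFB, ?_, ?_⟩
  · rw [Exchange.iff_contract_isBase hBX_indep]
    refine hY.isBase_of_eRk_ge (hF_fin.subset hYF) ?_
    rwa [← hX_base.encard_eq_eRank, hY.eRk_eq_encard]
  · have hsdiff : B₁ \ Y = B₁ \ F ∪ F \ Y := by grind
    constructor
    · simpa only [hsdiff, union_assoc] using hFYX_exchange.isBase
    · rw [hsdiff, disjoint_union_left]
      exact ⟨hFYX_exchange.disjoint.mono_right subset_union_right, hFYX_disj⟩

lemma Exchange.exists_exchange_union [M.Finitary] {B₀ B₁ U P X : Set α} (h : Exchange M B₁ U P)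
    (hB₀ : M.IsBase B₀) (hPB : P ⊆ B₀) (hXB : X ⊆ B₀) (hPX : Disjoint P X) (hX : X.Finite) :
    ∃ W ⊆ B₁ \ U, Exchange M B₀ X W ∧ Exchange M B₁ (U ∪ W) (P ∪ X) := by
  obtain ⟨W, hW, hXW, hWX⟩ := exists_symm_exchange hB₀ h.isBase hXB hX
  have hPW : Disjoint P W := hXW.disjoint.mono_left (subset_sdiff.2 ⟨hPB, hPX⟩)
  have hsdiff : (B₁ \ U ∪ P) \ W = B₁ \ (U ∪ W) ∪ P := by
    rw [union_sdiff_distrib, sdiff_sdiff, hPW.sdiff_eq_left]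
  have hWX_disj := hWX.disjoint
  rw [hsdiff, disjoint_union_left] at hWX_disj
  refine ⟨W, hPW.symm.left_le_of_le_sup_right hW, hXW, ?_, ?_⟩
  · simpa only [hsdiff, union_assoc] using hWX.isBase
  · refine disjoint_union_right.2 ⟨h.disjoint.mono_left ?_, hWX_disj.1⟩
    exact sdiff_subset_sdiff_right subset_union_left

lemma closure_iUnion_of_directed [M.Finitary] [Nonempty ι] {P : ι → Set α}
    (hP : Directed (· ⊆ ·) P) : M.closure (⋃ j, P j) = ⋃ j, M.closure (P j) := by
  refine subset_antisymm (fun e he ↦ ?_)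
    (iUnion_subset fun j ↦ M.closure_subset_closure (subset_iUnion P j))
  obtain ⟨F, hFP, hF, -, heF⟩ := Matroid.exists_subset_finite_closure_of_subset_closure
    (finite_singleton e) (singleton_subset_iff.2 he)
  lift F to Finset α using hF
  obtain ⟨j, hj⟩ := hP.exists_mem_subset_of_finset_subset_biUnion hFP
  exact mem_iUnion.2 ⟨j, M.closure_subset_closure hj (singleton_subset_iff.1 heF)⟩

namespace Exchange

variable {B C U P : Set α}

lemma subset_of_subset_closure (h : Exchange M B U P) (hB : M.IsBase B) (hUB : U ⊆ B) (hCB : C ⊆ B)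
    (hPC : P ⊆ M.closure C) : U ⊆ C := by
  intro e he
  by_contra heC
  have hsub : B \ U ∪ P ⊆ M.closure (B \ {e}) := by
    refine union_subset ?_ (hPC.trans (M.closure_subset_closure (subset_sdiff_singleton hCB heC)))
    exact (sdiff_subset_sdiff_right (singleton_subset_iff.2 he)).trans
      (M.subset_closure _ (sdiff_subset.trans hB.subset_ground))
  refine hB.indep.notMem_closure_sdiff_of_mem (hUB he) ?_
  apply M.closure_subset_closure_of_subset_closure hsub
  rw [h.isBase.closure_eq]
  exact hB.subset_ground (hUB he)

lemma inter_closure_subset (h : Exchange M B U P) : B ∩ M.closure P ⊆ U := by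
  rintro e ⟨heB, heP⟩
  by_contra heU
  have hmem : e ∈ M.closure P ∩ (B \ U ∪ P) := ⟨heP, .inl ⟨heB, heU⟩⟩
  rw [h.isBase.indep.closure_inter_eq_self_of_subset subset_union_right] at hmem
  exact h.disjoint.notMem_of_mem_left ⟨heB, heU⟩ hmem

lemma iUnion_eq_of_closure_eq [M.Finitary] {U P : ι → Set α} (h : ∀ j, Exchange M B (U j) (P j))
    (hB : M.IsBase B) (hUB : ∀ j, U j ⊆ B) (hP : Directed (· ⊆ ·) P) (hCB : C ⊆ B)
    (hC : M.closure C = M.closure (⋃ j, P j)) : ⋃ j, U j = C := by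
  refine subset_antisymm (iUnion_subset fun j ↦ ?_) fun e he ↦ ?_
  · refine (h j).subset_of_subset_closure hB (hUB j) hCB ?_
    have hPj : P j ⊆ M.E := subset_union_right.trans (h j).isBase.subset_ground
    exact (M.subset_closure _ hPj).trans (hC ▸ M.closure_subset_closure (subset_iUnion P j))
  · have heC : e ∈ M.closure C := M.mem_closure_of_mem he (hCB.trans hB.subset_ground)
    rw [hC] at heC
    cases isEmpty_or_nonempty ι
    · rw [iUnion_of_empty] at heC
      exact absurd heC (hB.indep.isNonloop_of_mem (hCB he)).not_isLoop
    · rw [closure_iUnion_of_directed hP] at heC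
      obtain ⟨j, hj⟩ := mem_iUnion.1 heC
      exact mem_iUnion.2 ⟨j, (h j).inter_closure_subset ⟨hCB he, hj⟩⟩

end Exchange

section Serial

variable [LinearOrder ι]

lemma iUnion_biUnion_le_of_isLowerSet {J : Set ι} (hJ : IsLowerSet J) (Z : ι → Set α) :
    ⋃ j : J, ⋃ k ≤ j.1, Z k = ⋃ k ∈ J, Z k := by
  refine subset_antisymm (iUnion_subset fun j ↦ ?_) (iUnion₂_subset fun k hk ↦ ?_)
  · exact iUnion₂_subset fun k hk ↦ subset_biUnion_of_mem (u := Z) (hJ hk j.2)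
  · exact fun x hx ↦ mem_iUnion.2 ⟨⟨k, hk⟩, mem_iUnion₂.2 ⟨k, le_rfl, hx⟩⟩

lemma Exchange.biUnion_eq_of_closure_eq [M.Finitary] {B C : Set α} {X Y : ι → Set α} {J : Set ι}
    (h : ∀ j ∈ J, Exchange M B (⋃ k ≤ j, Y k) (⋃ k ≤ j, X k)) (hJ : IsLowerSet J)
    (hB : M.IsBase B) (hYB : ∀ j ∈ J, Y j ⊆ B) (hCB : C ⊆ B)
    (hC : M.closure C = M.closure (⋃ k ∈ J, X k)) : ⋃ k ∈ J, Y k = C := by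
  rw [← iUnion_biUnion_le_of_isLowerSet hJ] at hC ⊢
  refine iUnion_eq_of_closure_eq (fun j : J ↦ h j j.2) hB
    (fun j ↦ iUnion₂_subset fun k hk ↦ hYB k (hJ hk j.2)) ?_ hCB hC
  have hmono : Monotone fun j : J ↦ ⋃ k ≤ j.1, X k := fun i j hij ↦
    biUnion_subset_biUnion_left fun k hk ↦ le_trans hk hij
  exact hmono.directed_le

lemma Exchange.biUnion_of_closure_eq [M.Finitary] {B C : Set α} {X Y : ι → Set α} {J : Set ι}
    (h : ∀ j ∈ J, Exchange M B (⋃ k ≤ j, Y k) (⋃ k ≤ j, X k)) (hJ : IsLowerSet J)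
    (hB : M.IsBase B) (hYB : ∀ j ∈ J, Y j ⊆ B) (hX : M.Indep (⋃ k ∈ J, X k)) (hCB : C ⊆ B)
    (hC : M.closure C = M.closure (⋃ k ∈ J, X k)) :
    Exchange M B (⋃ k ∈ J, Y k) (⋃ k ∈ J, X k) := by
  rw [biUnion_eq_of_closure_eq h hJ hB hYB hCB hC]
  exact .of_isBasis hB hCB (hB.indep.subset hCB).isBasis_closure (hC ▸ hX.isBasis_closure)

variable [WellFoundedLT ι]

lemma exists_forall_eq_apply_biUnion_lt (g : ι → Set α → Set α) :
    ∃ Y : ι → Set α, ∀ i, Y i = g i (⋃ k < i, Y k) :=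
  ⟨wellFounded_lt.fix fun i Y ↦ g i (⋃ k, ⋃ h : k < i, Y k h), fun i ↦ wellFounded_lt.fix_eq _ i⟩

variable [M.Finitary] {B₀ B₁ : Set α} {X : ι → Set α}

lemma exists_exchange_initial_segments (hB₀ : M.IsBase B₀) (hB₁ : M.IsBase B₁)
    (hXB : ∀ i, X i ⊆ B₀) (hXdisj : Pairwise fun i j ↦ Disjoint (X i) (X j))
    (hXfin : ∀ i, (X i).Finite)
    (hlim : ∀ i, Order.IsSuccPrelimit i →
      ∃ C ⊆ B₁, M.closure C = M.closure (⋃ k < i, X k)) :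
    ∃ Y : ι → Set α, ∀ i, Y i ⊆ B₁ \ (⋃ k < i, Y k) ∧ Exchange M B₀ (X i) (Y i) ∧
      Exchange M B₁ (⋃ k < i, Y k) (⋃ k < i, X k) ∧
      Exchange M B₁ (⋃ k ≤ i, Y k) (⋃ k ≤ i, X k) := by
  have hX_lt (i : ι) : ⋃ k < i, X k ⊆ B₀ := iUnion₂_subset fun k _ ↦ hXB k
  have hstep (i : ι) (U : Set α) (hU : Exchange M B₁ U (⋃ k < i, X k)) :
      ∃ W ⊆ B₁ \ U, Exchange M B₀ (X i) W ∧ Exchange M B₁ (U ∪ W) ((⋃ k < i, X k) ∪ X i) :=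
    hU.exists_exchange_union hB₀ (hX_lt i) (hXB i)
      (disjoint_iUnion₂_left.2 fun k hk ↦ hXdisj hk.ne) (hXfin i)
  choose! g hg_subset hg_exchange hg_union using hstep
  obtain ⟨Y, hY⟩ := exists_forall_eq_apply_biUnion_lt g
  have hle {i : ι} (h : Exchange M B₁ (⋃ k < i, Y k) (⋃ k < i, X k)) :
      Exchange M B₁ (⋃ k ≤ i, Y k) (⋃ k ≤ i, X k) := by
    have := hg_union i _ h
    rw [← hY] at this
    have hunion (Z : ι → Set α) : ⋃ k ≤ i, Z k = (⋃ k < i, Z k) ∪ Z i := biSup_le_eq_sup Z i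
    rwa [hunion, hunion]
  have hlt (i : ι) : Exchange M B₁ (⋃ k < i, Y k) (⋃ k < i, X k) := by
    induction i using WellFoundedLT.induction with
    | ind i ih =>
      by_cases hi : Order.IsSuccPrelimit i
      · obtain ⟨C, hCB, hC⟩ := hlim i hi
        have hYB (j : ι) (hj : j ∈ Iio i) : Y j ⊆ B₁ := by
          rw [hY]
          exact (hg_subset j _ (ih j hj)).trans sdiff_subset
        exact .biUnion_of_closure_eq (fun j hj ↦ hle (ih j hj)) (isLowerSet_Iio i) hB₁ hYB
          (hB₀.indep.subset (hX_lt i)) hCB hC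
      · obtain ⟨p, hp⟩ := Order.not_isSuccPrelimit_iff.1 hi
        have (k : ι) : k < i ↔ k ≤ p := by
          rw [← mem_Iio, hp.Iio_eq, mem_Iic]
        simp only [this]
        exact hle (ih p hp.lt)
  refine ⟨Y, fun i ↦ ⟨?_, ?_, hlt i, hle (hlt i)⟩⟩ <;> rw [hY i]
  · exact hg_subset i _ (hlt i)
  · exact hg_exchange i _ (hlt i)

lemma exists_serial_exchange (hB₀ : M.IsBase B₀) (hB₁ : M.IsBase B₁) (hX : ⋃ i, X i = B₀)
    (hXdisj : Pairwise fun i j ↦ Disjoint (X i) (X j)) (hXfin : ∀ i, (X i).Finite)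
    (hlim : ∀ i, Order.IsSuccPrelimit i →
      ∃ C ⊆ B₁, M.closure C = M.closure (⋃ k < i, X k)) :
    ∃ Y : ι → Set α, (Pairwise fun i j ↦ Disjoint (Y i) (Y j)) ∧ ⋃ i, Y i = B₁ ∧
      (∀ i, Exchange M B₀ (X i) (Y i)) ∧
      ∀ i, Exchange M B₁ (⋃ k < i, Y k) (⋃ k < i, X k) := by
  obtain ⟨Y, hY⟩ := exists_exchange_initial_segments hB₀ hB₁ (fun i ↦ hX ▸ subset_iUnion X i)
    hXdisj hXfin hlim
  choose hY_subset hexch hlt hle using hY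
  refine ⟨Y, ?_, ?_, hexch, hlt⟩
  · refine (pairwise_disjoint_on Y).2 fun i j hij ↦ ?_
    exact (disjoint_sdiff_right.mono_right (hY_subset j)).mono_left
      (subset_biUnion_of_mem (u := Y) hij)
  · simpa using Exchange.biUnion_eq_of_closure_eq (J := univ) (fun j _ ↦ hle j) isLowerSet_univ hB₁
      (fun j _ ↦ (hY_subset j).trans sdiff_subset) Subset.rfl
      (by simp [hX, hB₀.closure_eq, hB₁.closure_eq])

end Serial

section Reordering

lemma type_eq_ord_mk_of_forall_mk_lt (r : ι → ι → Prop) [IsWellOrder ι r]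
    (h : ∀ i, #{j // r j i} < #ι) : Ordinal.type r = ord #ι := by
  refine le_antisymm (le_of_not_gt fun hlt ↦ ?_) (ord_le_type r)
  obtain ⟨i, hi⟩ := Ordinal.typein_surj r hlt
  have := congrArg Ordinal.card hi
  rw [Ordinal.card_typein, card_ord] at this
  exact (h i).ne this

lemma infinite_Ico_of_isSuccPrelimit [LinearOrder ι] {i j : ι}
    (hi : Order.IsSuccPrelimit i) (hji : j < i) : (Ico j i).Infinite := by
  intro hfin
  obtain ⟨p, hp, hmax⟩ := exists_max_image _ id hfin ⟨j, le_rfl, hji⟩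
  refine hi p ⟨hp.2, fun k hpk hki ↦ ?_⟩
  exact (hmax k ⟨hp.1.trans hpk.le, hki⟩).not_gt hpk

lemma countable_setOf_reflTransGen {G : ι → Set ι} (hG : ∀ i, (G i).Countable)
    (a : ι) : {i | Relation.ReflTransGen (fun x y ↦ y ∈ G x) a i}.Countable := by
  let A : ℕ → Set ι := Nat.rec {a} fun _ S ↦ ⋃ i ∈ S, G i
  have hA (n : ℕ) : (A n).Countable := by
    induction n with
    | zero => exact countable_singleton a
    | succ n ih => exact ih.biUnion fun i _ ↦ hG i
  refine (countable_iUnion hA).mono fun i hi ↦ ?_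
  induction hi with
  | refl => exact mem_iUnion.2 ⟨0, rfl⟩
  | tail _ hbc ih =>
    obtain ⟨n, hn⟩ := mem_iUnion.1 ih
    exact mem_iUnion.2 ⟨n + 1, mem_biUnion hn hbc⟩

section LeastSource

variable [LinearOrder ι] [WellFoundedLT ι] {G : ι → Set ι}

/-- The least index from which `i` can be reached by finitely many steps `x ⟶ y` with `y ∈ G x`.
Listing uncountably many indices in the order of their least sources makes the initial segments of
limit length closed under a countable-valued `G`. -/
noncomputable def leastSource (G : ι → Set ι) (i : ι) : ι :=
  wellFounded_lt.min {a | Relation.ReflTransGen (fun x y ↦ y ∈ G x) a i} ⟨i, .refl⟩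

lemma reflTransGen_leastSource (G : ι → Set ι) (i : ι) :
    Relation.ReflTransGen (fun x y ↦ y ∈ G x) (leastSource G i) i :=
  wellFounded_lt.min_mem {a | Relation.ReflTransGen (fun x y ↦ y ∈ G x) a i} _

lemma leastSource_le_leastSource {i k : ι} (hk : k ∈ G i) : leastSource G k ≤ leastSource G i :=
  wellFounded_lt.min_le (s := {a | Relation.ReflTransGen (fun x y ↦ y ∈ G x) a k})
    ((reflTransGen_leastSource G i).tail hk)

lemma countable_preimage_leastSource (hG : ∀ i, (G i).Countable) (a : ι) :
    (leastSource G ⁻¹' {a}).Countable := by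
  refine (countable_setOf_reflTransGen hG a).mono ?_
  rintro i rfl
  exact reflTransGen_leastSource G i

end LeastSource

variable {ι : Type u} [LinearOrder ι] [WellFoundedLT ι]

lemma exists_perm_strictMono_comp {β : Type*} [LinearOrder β] [WellFoundedLT β]
    (hι : ord #ι = typeLT ι) {φ : ι → β} (hφ : Function.Injective φ)
    (hseg : ∀ i, #{j // φ j < φ i} < #ι) : ∃ σ : Equiv.Perm ι, StrictMono (φ ∘ σ) := by
  have : IsWellOrder ι (φ ⁻¹'o (· < ·)) := (RelEmbedding.preimage ⟨φ, hφ⟩ (· < ·)).isWellOrder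
  obtain ⟨e⟩ := Ordinal.type_eq.1
    (hι.symm.trans (type_eq_ord_mk_of_forall_mk_lt (φ ⁻¹'o (· < ·)) hseg).symm)
  exact ⟨e.toEquiv, fun i j hij ↦ e.map_rel_iff.2 hij⟩

lemma exists_injective_prodMk_nat {ι β : Type*} {ρ : ι → β} (hρ : ∀ b, (ρ ⁻¹' {b}).Countable) :
    ∃ f : ι → ℕ, Function.Injective fun i ↦ (ρ i, f i) := by
  choose f hf using fun b ↦ countable_iff_exists_injOn.1 (hρ b)
  refine ⟨fun i ↦ f (ρ i) i, fun i j hij ↦ ?_⟩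
  obtain ⟨hρij, hfij⟩ := Prod.mk_inj.1 hij
  dsimp only at hfij
  rw [← hρij] at hfij
  exact hf (ρ i) rfl hρij.symm hfij

lemma mk_setOf_toLex_lt_lt (hι : ord #ι = typeLT ι) (hunc : ℵ₀ < #ι) {ρ : ι → ι} {f : ι → ℕ}
    (hinj : Function.Injective fun i ↦ (ρ i, f i)) (i : ι) :
    #{j // toLex (ρ j, f j) < toLex (ρ i, f i)} < #ι := by
  have hIic : #(Iic (ρ i)) < #ι := by
    rw [← Iio_insert]
    exact mk_insert_le.trans_lt (add_lt_of_lt hunc.le (mk_Iio_lt _ hι) (one_lt_aleph0.trans hunc))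
  calc #{j | toLex (ρ j, f j) < toLex (ρ i, f i)}
    _ ≤ #((fun j ↦ (ρ j, f j)) ⁻¹' Iic (ρ i) ×ˢ Set.univ) := mk_le_mk_of_subset fun j hj ↦
      ⟨(Prod.Lex.toLex_lt_toLex.1 hj).elim le_of_lt fun h ↦ h.1.le, mem_univ _⟩
    _ ≤ #(Iic (ρ i) ×ˢ (Set.univ : Set ℕ) : Set (ι × ℕ)) := mk_preimage_of_injective _ _ hinj
    _ = #(Iic (ρ i)) * ℵ₀ := (mk_congr (Equiv.Set.prod _ _)).trans (by simp)
    _ < #ι := mul_lt_of_lt hunc.le hIic hunc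

lemma exists_perm_monotone_comp (hι : ord #ι = typeLT ι) (hunc : ℵ₀ < #ι) {ρ : ι → ι}
    (hρ : ∀ a, (ρ ⁻¹' {a}).Countable) :
    ∃ σ : Equiv.Perm ι, Monotone (ρ ∘ σ) ∧ ∀ i, {j | j < i ∧ ρ (σ j) = ρ (σ i)}.Finite := by
  obtain ⟨f, hf⟩ := exists_injective_prodMk_nat hρ
  obtain ⟨σ, hσ⟩ := exists_perm_strictMono_comp hι (toLex.injective.comp hf)
    (mk_setOf_toLex_lt_lt hι hunc hf)
  have hlex {i j : ι} (hij : i < j) :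
      ρ (σ i) < ρ (σ j) ∨ ρ (σ i) = ρ (σ j) ∧ f (σ i) < f (σ j) :=
    Prod.Lex.toLex_lt_toLex.1 (hσ hij)
  refine ⟨σ, monotone_iff_forall_lt.2 fun i j hij ↦ (hlex hij).elim le_of_lt fun h ↦ h.1.le,
    fun i ↦ Finite.of_injOn (f := f ∘ σ) (t := Iio (f (σ i))) ?_ ?_ (finite_Iio _)⟩
  · exact fun j hj ↦ ((hlex hj.1).resolve_left hj.2.not_lt).2
  · exact fun j hj k hk hjk ↦ σ.injective (hf (Prod.ext (hj.2.trans hk.2.symm) hjk))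

lemma exists_perm_forall_isSuccPrelimit_closed (hι : ord #ι = typeLT ι) (hunc : ℵ₀ < #ι)
    {G : ι → Set ι} (hG : ∀ i, (G i).Countable) :
    ∃ σ : Equiv.Perm ι, ∀ i, Order.IsSuccPrelimit i → ∀ j ∈ σ '' Iio i, G j ⊆ σ '' Iio i := by
  obtain ⟨σ, hmono, hfin⟩ :=
    exists_perm_monotone_comp hι hunc (countable_preimage_leastSource hG)
  refine ⟨σ, fun i hi ↦ ?_⟩
  rintro _ ⟨j, hj, rfl⟩ k hk
  have hji : leastSource G (σ j) < leastSource G (σ i) := by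
    refine (hmono (le_of_lt hj)).lt_of_ne fun heq ↦ infinite_Ico_of_isSuccPrelimit hi hj ?_
    refine (hfin i).subset fun l hl ↦ ⟨hl.2, (hmono hl.2.le).antisymm ?_⟩
    exact heq.symm.trans_le (hmono hl.1)
  refine ⟨σ.symm k, lt_of_not_ge fun hik ↦ ?_, σ.apply_symm_apply k⟩
  have := hmono hik
  simp only [Function.comp_apply, σ.apply_symm_apply] at this
  exact ((leastSource_le_leastSource hk).trans_lt hji).not_ge this

end Reordering

section Dependence

variable [M.Finitary] {B₀ B₁ : Set α}

lemma exists_countable_dependence (hB₀ : M.IsBase B₀) (hB₁ : M.IsBase B₁) {X : ι → Set α}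
    (hX : ⋃ i, X i = B₀) (hXdisj : Pairwise fun i j ↦ Disjoint (X i) (X j))
    (hXfin : ∀ i, (X i).Finite) :
    ∃ G : ι → Set ι, (∀ i, (G i).Countable) ∧ ∀ J : Set ι, (∀ i ∈ J, G i ⊆ J) →
      ∃ C ⊆ B₁, M.closure C = M.closure (⋃ k ∈ J, X k) := by
  have hXB (i : ι) : X i ⊆ B₀ := hX ▸ subset_iUnion X i
  choose F hFB hF _ hXF using fun i ↦
    Matroid.exists_subset_finite_closure_of_subset_closure (hXfin i)
      ((hXB i).trans (hB₀.subset_ground.trans_eq hB₁.closure_eq.symm))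
  choose D hDB hD _ hFD using fun i ↦
    Matroid.exists_subset_finite_closure_of_subset_closure (hF i)
      ((hFB i).trans (hB₁.subset_ground.trans_eq hB₀.closure_eq.symm))
  -- `F i` and `D i` are finite subsets of `B₁` and `B₀` with `X i` in the span of `F i` and `F i`
  -- in the span of `D i`; the index `i` depends on the indices of the blocks that meet `D i`.
  refine ⟨fun i ↦ ⋃ d ∈ D i, {k | d ∈ X k}, fun i ↦ (hD i).countable.biUnion fun d _ ↦ ?_,
    fun J hJ ↦ ⟨⋃ i ∈ J, F i, iUnion₂_subset fun i _ ↦ hFB i, ?_⟩⟩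
  · refine Subsingleton.countable fun k hk l hl ↦ ?_
    by_contra hkl
    exact (hXdisj hkl).notMem_of_mem_left hk hl
  · refine (M.closure_subset_closure_of_subset_closure ?_).antisymm
      (M.closure_subset_closure_of_subset_closure ?_) <;> refine iUnion₂_subset fun i hi ↦ ?_
    · refine (hFD i).trans (M.closure_subset_closure fun d hd ↦ ?_)
      obtain ⟨k, hk⟩ := mem_iUnion.1 (hX ▸ hDB i hd)
      exact mem_biUnion (hJ i hi (mem_biUnion hd hk)) hk
    · exact (hXF i).trans (M.closure_subset_closure (subset_biUnion_of_mem hi))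

lemma exists_perm_forall_isSuccPrelimit_closure_eq {ι : Type u} [LinearOrder ι] [WellFoundedLT ι]
    (hι : ord #ι = typeLT ι) (hB₀ : M.IsBase B₀) (hB₁ : M.IsBase B₁) {X : ι → Set α}
    (hX : ⋃ i, X i = B₀) (hXdisj : Pairwise fun i j ↦ Disjoint (X i) (X j))
    (hXfin : ∀ i, (X i).Finite) :
    ∃ σ : Equiv.Perm ι, (∀ i, Order.IsSuccPrelimit i →
      ∃ C ⊆ B₁, M.closure C = M.closure (⋃ k < i, X (σ k))) ∧ (#ι ≤ ℵ₀ → σ = Equiv.refl ι) := by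
  obtain hcount | hunc := le_or_gt #ι ℵ₀
  · refine ⟨Equiv.refl ι, fun i hi ↦ ⟨∅, empty_subset B₁, ?_⟩, fun _ ↦ rfl⟩
    have hfin : (Iio i).Finite := lt_aleph0_iff_set_finite.1 ((mk_Iio_lt i hι).trans_le hcount)
    have hmin (k : ι) : ¬ k < i := fun hk ↦
      infinite_Ico_of_isSuccPrelimit hi hk (hfin.subset Ico_subset_Iio_self)
    simp [hmin]
  · obtain ⟨G, hG, hclosed⟩ := exists_countable_dependence hB₀ hB₁ hX hXdisj hXfin
    obtain ⟨σ, hσ⟩ := exists_perm_forall_isSuccPrelimit_closed hι hunc hG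
    refine ⟨σ, fun i hi ↦ ?_, fun hcount ↦ (hunc.not_ge hcount).elim⟩
    simpa only [biUnion_image, mem_Iio] using hclosed (σ '' Iio i) (hσ i hi)

end Dependence

lemma iUnion_sdiff_biUnion {Z : ι → Set α} (hZ : Pairwise fun i j ↦ Disjoint (Z i) (Z j))
    (J : Set ι) : (⋃ j, Z j) \ (⋃ k ∈ J, Z k) = ⋃ j ∈ Jᶜ, Z j := by
  simpa [compl_eq_univ_sdiff] using biUnion_sdiff_biUnion_eq (s := univ) (hZ.set_pairwise _)

lemma Exchange.isBase_sdiff_biUnion_compl_union {X Y : ι → Set α}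
    (hX : Pairwise fun i j ↦ Disjoint (X i) (X j)) (hY : Pairwise fun i j ↦ Disjoint (Y i) (Y j))
    {J : Set ι} (h : Exchange M (⋃ i, Y i) (⋃ k ∈ J, Y k) (⋃ k ∈ J, X k)) :
    M.IsBase ((⋃ i, X i) \ (⋃ k ∈ Jᶜ, X k) ∪ ⋃ k ∈ Jᶜ, Y k) := by
  rw [iUnion_sdiff_biUnion hX, compl_compl, ← iUnion_sdiff_biUnion hY, union_comm]
  exact h.isBase

theorem mainTheorem1 {α : Type u} (M : Matroid α) [M.Finitary] (B₀ B₁ : Set α)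
    (hB₀ : M.IsBase B₀) (hB₁ : M.IsBase B₁)
    (κ : Cardinal.{v}) (X : Set.Iio κ.ord → Set α)
    (hXdisj : Pairwise fun i j => Disjoint (X i) (X j))
    (hXunion : ⋃ i, X i = B₀)
    (hXfin : ∀ i, (X i).Finite) :
    ∃ (Y : Set.Iio κ.ord → Set α) (σ : Equiv.Perm (Set.Iio κ.ord)),
      (Pairwise fun i j => Disjoint (Y i) (Y j)) ∧
      (⋃ i, Y i = B₁) ∧
      (∀ i, (X i).Nonempty → (Y i).Nonempty) ∧
      (∀ i, M.IsBase ((B₀ \ X i) ∪ Y i)) ∧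
      (∀ i, M.IsBase ((B₀ \ ⋃ j ≥ i, X (σ j)) ∪ ⋃ j ≥ i, Y (σ j))) ∧
      (κ ≤ Cardinal.aleph0 → σ = Equiv.refl _) := by
  have hκ : ord #(Iio κ.ord) = typeLT (Iio κ.ord) := by
    rw [Cardinal.mk_Iio_ordinal, Ordinal.type_lt_Iio, card_ord, lift_ord]
  obtain ⟨σ, hlim, hσ⟩ :=
    exists_perm_forall_isSuccPrelimit_closure_eq hκ hB₀ hB₁ hXunion hXdisj hXfin
  have hXσ : ⋃ i, X (σ i) = B₀ := (σ.surjective.iUnion_comp X).trans hXunion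
  have hXσdisj : Pairwise fun i j ↦ Disjoint (X (σ i)) (X (σ j)) :=
    fun i j hij ↦ hXdisj (σ.injective.ne hij)
  obtain ⟨Y, hYdisj, hY, hexch, hinit⟩ :=
    exists_serial_exchange hB₀ hB₁ hXσ hXσdisj (fun i ↦ hXfin (σ i)) hlim
  have hexch (i) : Exchange M B₀ (X i) (Y (σ.symm i)) := by simpa using hexch (σ.symm i)
  refine ⟨Y ∘ σ.symm, σ, fun i j hij ↦ hYdisj (σ.symm.injective.ne hij),
    (σ.symm.surjective.iUnion_comp Y).trans hY,
    fun i ↦ (hexch i).nonempty hB₀ (hXunion ▸ subset_iUnion X i),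
    fun i ↦ (hexch i).isBase, fun i ↦ ?_, fun h ↦ hσ (by simpa using h)⟩
  rw [← hXσ]
  have := Exchange.isBase_sdiff_biUnion_compl_union hXσdisj hYdisj (J := Iio i) (hY ▸ hinit i)
  simpa only [compl_Iio, mem_Ici, Function.comp_apply, σ.symm_apply_apply] using this
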